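/- Let $N \ge 1$ and let $F \in \mathbb{C}^{N\times N}$ be the discrete Fourier transform matrix, $F_{jk} = e^{-2\pi i jk/N}$ for $0 \le j,k \le N-1$. For $K \ge 1$, an order-$K$ AFDF transform on $\mathbb{C}^N$ is a map $x \mapsto x\,\prod_{k=1}^{K} A_k F D_k F^{-1}$ on row vectors (factors written from left to right in order of increasing $k$), where $A_1,\dots,A_K$ and $D_1,\dots,D_K$ are complex diagonal $N \times N$ matrices and $A_1 = I$. Theorem. Order-$N$ AFDF transforms approximate every linear operator on $\mathbb{C}^N$ to arbitrary precision: the set of matrices $$\Big\{ \prod_{k=1}^{N} A_k F D_k F^{-1} \;:\; A_k, D_k \in \mathbb{C}^{N\times N} \text{ diagonal for } 1 \le k \le N,\ A_1 = I \Big\}$$ is dense in $\mathbb{C}^{N\times N}$ (for the usual topology). -/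

import Mathlib

open scoped Matrix

/-- The `N × N` discrete Fourier transform matrix `F`, with rows and columns indexed by
`ℤ / N ℤ = {0, …, N - 1}` and entries `exp (-2 π i j k / N)`. It is the matrix of Mathlib's
`ZMod.dft`. -/
noncomputable def dftMatrix (N : ℕ) [NeZero N] : Matrix (ZMod N) (ZMod N) ℂ :=
  LinearMap.toMatrix' (ZMod.dft (N := N) (E := ℂ)).toLinearMap

theorem dftMatrix_apply (N : ℕ) [NeZero N] (j k : ZMod N) :
    dftMatrix N j k = ZMod.stdAddChar (-(j * k)) := by
  simp [dftMatrix, LinearMap.toMatrix'_apply, ZMod.dft_apply, Pi.single_apply, mul_comm]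

/-- `F` is invertible, so `F⁻¹` below is a genuine inverse. -/
theorem isUnit_dftMatrix (N : ℕ) [NeZero N] : IsUnit (dftMatrix N) := by
  refine IsUnit.of_mul_eq_one
    (LinearMap.toMatrix' (ZMod.dft (N := N) (E := ℂ)).symm.toLinearMap) ?_
  rw [dftMatrix, ← LinearMap.toMatrix'_comp]
  simp

/-- `F` is symmetric: multiplying a row vector by `F` on the right is the Fourier transform. -/
theorem vecMul_dftMatrix (N : ℕ) [NeZero N] (x : ZMod N → ℂ) :
    x ᵥ* dftMatrix N = ZMod.dft x := by
  ext k
  simp [Matrix.vecMul, dotProduct, dftMatrix_apply, ZMod.dft_apply, mul_comm]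

/-- One AFDF factor `A F D F⁻¹`, where `A = diag a` and `D = diag d`. -/
noncomputable def afdfFactor (N : ℕ) [NeZero N] (a d : ZMod N → ℂ) :
    Matrix (ZMod N) (ZMod N) ℂ :=
  Matrix.diagonal a * dftMatrix N * Matrix.diagonal d * (dftMatrix N)⁻¹

/-- The matrix `∏_{k=1}^K A_k F D_k F⁻¹` (factors in increasing order of `k` from left to right)
by which an order-`K` AFDF transform multiplies a row vector on the right. The index `k` runs
through `Fin K`, so that `A_1` is `A 0`. -/
noncomputable def afdfProduct (N : ℕ) [NeZero N] (K : ℕ) (A D : Fin K → ZMod N → ℂ) :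
    Matrix (ZMod N) (ZMod N) ℂ :=
  (List.ofFn fun k : Fin K => afdfFactor N (A k) (D k)).prod

/-- The linear operators realised by order-`K` AFDF transforms on `ℂ^N`, with the normalisation
`A_1 = I`. -/
def afdfOperators (N : ℕ) [NeZero N] (K : ℕ) : Set (Matrix (ZMod N) (ZMod N) ℂ) :=
  {W | ∃ A D : Fin K → ZMod N → ℂ,
    (∀ k : Fin K, (k : ℕ) = 0 → Matrix.diagonal (A k) = 1) ∧ W = afdfProduct N K A D}

/-! The product is a polynomial map of the diagonal entries, so its range is constructible
(Chevalley). If the differential is onto at one point, the range has interior and hence contains the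
complement of a hypersurface, which is dense (`MvPolynomial.denseRange_of_span_eq_top`). The point
is D_k = I and A_k = B = diag(1, ..., N) for k > 1. Moving one D_k along a character replaces F D_k
F⁻¹ by a cyclic shift S, with velocity B^k S B^(N-1-k), k counted from 0. For a nonzero shift the
ratios of entries of B are distinct, so a projective Vandermonde argument gives the whole cyclic
diagonal (`exists_sum_diagonal_pow_mul_shift_mul_eq_single`). The main diagonal comes from moving
A_2. -/

/-! ### Polynomial maps with dense range -/

theorem MvPolynomial.eq_zero_of_eval_eq_zero_on_open {σ : Type*} {U : Set (σ → ℂ)}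
    (hU : IsOpen U) (hne : U.Nonempty) (p : MvPolynomial σ ℂ)
    (h : ∀ x ∈ U, MvPolynomial.eval x p = 0) : p = 0 := by
  obtain ⟨x, hx⟩ := hne
  obtain ⟨I, u, hu, hsub⟩ := isOpen_pi_iff.mp hU x hx
  classical
  refine MvPolynomial.funext_set (fun i => if i ∈ I then u i else Set.univ) (fun i => ?_)
    fun y hy => ?_
  · split_ifs with hi
    · exact infinite_of_mem_nhds (x i) ((hu i hi).1.mem_nhds (hu i hi).2)
    · exact Set.infinite_univ
  · rw [map_zero]
    refine h y (hsub fun i hi => ?_)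
    simpa [Finset.mem_coe.mp hi] using hy i (Set.mem_univ i)

/-- A polynomial map whose range has an interior point has a range that contains the
complement of a hypersurface. -/
theorem MvPolynomial.exists_ne_zero_forall_mem_range {σ τ : Type*} [Finite σ] [Finite τ]
    (f : σ → MvPolynomial τ ℂ)
    (h : (interior (Set.range fun (x : τ → ℂ) i => MvPolynomial.eval x (f i))).Nonempty) :
    ∃ g : MvPolynomial σ ℂ, g ≠ 0 ∧ ∀ y : σ → ℂ, MvPolynomial.eval y g ≠ 0 →
      y ∈ Set.range fun (x : τ → ℂ) i => MvPolynomial.eval x (f i) := by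
  have heval (x : τ → ℂ) (g : MvPolynomial σ ℂ) : eval x (aeval f g) =
      eval (fun i => eval x (f i)) g := by
    have h : (eval x).comp (aeval f : MvPolynomial σ ℂ →ₐ[ℂ] _).toRingHom =
        eval (fun i => eval x (f i)) := ringHom_ext (by simp) (by simp)
    exact congrFun (congrArg DFunLike.coe h) g
  let φ : MvPolynomial σ ℂ →+* MvPolynomial τ ℂ := (aeval f : _ →ₐ[ℂ] _).toRingHom
  have hinj : Function.Injective φ := by
    refine (injective_iff_map_eq_zero φ).mpr fun g hg => ?_
    refine eq_zero_of_eval_eq_zero_on_open isOpen_interior h g fun y hy => ?_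
    obtain ⟨x, rfl⟩ := interior_subset hy
    rw [← heval]
    exact (congrArg (eval x) hg).trans (map_zero _)
  have hfp : φ.FinitePresentation := by
    have h1 : (φ.comp (C : ℂ →+* MvPolynomial σ ℂ)).FiniteType := by
      have : φ.comp (C : ℂ →+* MvPolynomial σ ℂ) = algebraMap ℂ (MvPolynomial τ ℂ) := by
        ext; simp [φ]
      rw [this, RingHom.finiteType_algebraMap]
      infer_instance
    exact RingHom.FinitePresentation.of_finiteType.mp (RingHom.FiniteType.of_comp_finiteType h1)
  -- Chevalley's theorem; injectivity of `φ` then puts the generic point in the image.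
  obtain ⟨S, hS⟩ := PrimeSpectrum.exists_constructibleSetData_iff.mpr
    (PrimeSpectrum.isConstructible_range_comap hfp)
  have hbot : (⊥ : PrimeSpectrum (MvPolynomial σ ℂ)) ∈ S.toSet := by
    rw [hS]
    refine ⟨⊥, ?_⟩
    ext1
    exact (RingHom.injective_iff_ker_eq_bot φ).mp hinj
  obtain ⟨C₀, hC₀, hmem⟩ := Set.mem_iUnion₂.mp hbot
  obtain ⟨hg, hf⟩ := hmem
  -- A closed set containing the generic point is everything, so this piece is the basic open set of
  -- `C₀.f`.
  have hg0 : ∀ i, C₀.g i = 0 := fun i => by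
    simpa using hg ⟨i, rfl⟩
  refine ⟨C₀.f, fun h0 => hf (by simp [h0]), fun y hy => ?_⟩
  let m : PrimeSpectrum (MvPolynomial σ ℂ) :=
    ⟨vanishingIdeal ℂ {y}, (isMaximal_iff_eq_vanishingIdeal_singleton.mpr ⟨y, rfl⟩).isPrime⟩
  have hm : m ∈ S.toSet := by
    refine Set.mem_iUnion₂.mpr ⟨C₀, hC₀, ?_, ?_⟩
    · rintro _ ⟨i, rfl⟩
      rw [hg0 i]
      exact zero_mem m.asIdeal
    · intro hf
      have hf' : C₀.f ∈ vanishingIdeal ℂ {y} := hf rfl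
      exact hy (by simpa [mem_vanishingIdeal_iff] using hf')
  rw [hS] at hm
  obtain ⟨q, hq⟩ := hm
  -- By the Nullstellensatz, a maximal ideal above `q` is a point `x`; it maps to `y`.
  obtain ⟨M, hM, hqM⟩ := Ideal.exists_le_maximal q.asIdeal q.isPrime.ne_top
  obtain ⟨x, rfl⟩ := isMaximal_iff_eq_vanishingIdeal_singleton.mp hM
  refine ⟨x, _root_.funext fun i => ?_⟩
  have hi : X i - C (y i) ∈ m.asIdeal := by
    simp [m, mem_vanishingIdeal_iff]
  rw [← hq] at hi
  have hi' := hqM hi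
  simpa [mem_vanishingIdeal_iff, φ, sub_eq_zero] using hi'

/-- A polynomial map whose range has an interior point has dense range. -/
theorem MvPolynomial.denseRange_of_interior_nonempty {σ τ : Type*} [Finite σ] [Finite τ]
    (f : σ → MvPolynomial τ ℂ)
    (h : (interior (Set.range fun (x : τ → ℂ) i => MvPolynomial.eval x (f i))).Nonempty) :
    DenseRange fun (x : τ → ℂ) i => MvPolynomial.eval x (f i) := by
  obtain ⟨g, hg, hrange⟩ := exists_ne_zero_forall_mem_range f h
  refine dense_iff_inter_open.mpr fun U hU hne => ?_
  by_contra hempty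
  refine hg (eq_zero_of_eval_eq_zero_on_open hU hne g fun y hy => ?_)
  by_contra hy0
  exact hempty ⟨y, hy, hrange y hy0⟩

/-- A polynomial map has dense range if, at some point `p`, the velocities of its restrictions to
lines through `p` on which it is affine span the target. -/
theorem MvPolynomial.denseRange_of_span_eq_top {σ τ : Type*} [Finite σ] [Finite τ]
    (f : σ → MvPolynomial τ ℂ) (p : τ → ℂ)
    (h : Submodule.span ℂ {v : σ → ℂ | ∃ u : τ → ℂ, ∀ (t : ℂ) (i : σ),
      MvPolynomial.eval (p + t • u) (f i) = MvPolynomial.eval p (f i) + t * v i} = ⊤) :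
    DenseRange fun (x : τ → ℂ) i => MvPolynomial.eval x (f i) := by
  cases nonempty_fintype σ
  cases nonempty_fintype τ
  set Φ : (τ → ℂ) → (σ → ℂ) := fun x i => eval x (f i) with hΦ
  have hcd : AnalyticAt ℂ Φ p :=
    AnalyticAt.pi fun i => AnalyticOnNhd.eval_mvPolynomial (f i) p (Set.mem_univ p)
  have hstrict := hcd.hasStrictFDerivAt
  have hsurj : (fderiv ℂ Φ p).range = ⊤ := by
    rw [eq_top_iff, ← h, Submodule.span_le]
    rintro v ⟨u, hu⟩
    refine ⟨u, ?_⟩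
    have h1 : HasLineDerivAt ℂ Φ (fderiv ℂ Φ p u) p u :=
      hcd.differentiableAt.hasFDerivAt.hasLineDerivAt u
    have h2 : HasLineDerivAt ℂ Φ v p u := by
      have : (fun t : ℂ => Φ (p + t • u)) = fun t => Φ p + t • v := by
        funext t i
        simpa [hΦ] using hu t i
      rw [HasLineDerivAt, this]
      simpa using ((hasDerivAt_id (0 : ℂ)).smul_const v).const_add (Φ p)
    exact h1.unique h2
  refine denseRange_of_interior_nonempty f ⟨Φ p, mem_interior_iff_mem_nhds.mpr ?_⟩
  rw [← hstrict.map_nhds_eq_of_surj hsurj]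
  exact Filter.range_mem_map

/-! ### AFDF factors and products with one factor changed -/

/-- With a diagonal matrix of a character in the middle, `F D F⁻¹` is a cyclic shift. -/
theorem afdfFactor_stdAddChar (N : ℕ) [NeZero N] (a : ZMod N → ℂ) (s : ZMod N) :
    afdfFactor N a (fun k => ZMod.stdAddChar (-(s * k))) =
      Matrix.diagonal a * Matrix.of fun j k => if k = j + s then 1 else 0 := by
  have h : dftMatrix N * Matrix.diagonal (fun k => ZMod.stdAddChar (-(s * k))) =
      (Matrix.of fun j k => if k = j + s then 1 else 0) * dftMatrix N := by
    ext j k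
    rw [Matrix.mul_diagonal, Matrix.mul_apply]
    simp only [Matrix.of_apply, ite_mul, one_mul, zero_mul, Finset.sum_ite_eq', Finset.mem_univ,
      if_true, dftMatrix_apply]
    rw [← AddChar.map_add_eq_mul]
    congr 1
    ring
  rw [afdfFactor, Matrix.mul_assoc (Matrix.diagonal a), h, Matrix.mul_assoc, Matrix.mul_assoc,
    Matrix.mul_nonsing_inv _ ((Matrix.isUnit_iff_isUnit_det _).mp (isUnit_dftMatrix N)),
    Matrix.mul_one]

theorem afdfFactor_one_right (N : ℕ) [NeZero N] (a : ZMod N → ℂ) :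
    afdfFactor N a 1 = Matrix.diagonal a := by
  rw [afdfFactor, Matrix.diagonal_one', Matrix.mul_one, Matrix.mul_assoc,
    Matrix.mul_nonsing_inv _ ((Matrix.isUnit_iff_isUnit_det _).mp (isUnit_dftMatrix N)),
    Matrix.mul_one]

theorem diagonal_add_smul {n R : Type*} [DecidableEq n] [Semiring R] (a α : n → R) (t : R) :
    Matrix.diagonal (a + t • α) = Matrix.diagonal a + t • Matrix.diagonal α := by
  rw [← Matrix.diagonal_smul, Matrix.diagonal_add]
  rfl

theorem afdfFactor_add_smul_left (N : ℕ) [NeZero N] (a α d : ZMod N → ℂ) (t : ℂ) :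
    afdfFactor N (a + t • α) d = afdfFactor N a d + t • afdfFactor N α d := by
  simp only [afdfFactor, diagonal_add_smul, Matrix.add_mul,
    Matrix.smul_mul]

theorem afdfFactor_add_smul_right (N : ℕ) [NeZero N] (a d δ : ZMod N → ℂ) (t : ℂ) :
    afdfFactor N a (d + t • δ) = afdfFactor N a d + t • afdfFactor N a δ := by
  simp only [afdfFactor, diagonal_add_smul, Matrix.add_mul,
    Matrix.mul_add, Matrix.smul_mul, Matrix.mul_smul]

theorem List.prod_ofFn_update_const {M : Type*} [Monoid M] {n : ℕ} (B Y : M) (k : Fin n) :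
    (List.ofFn (Function.update (fun _ => B) k Y)).prod = B ^ (k : ℕ) * Y * B ^ (n - 1 - k) := by
  have h : List.ofFn (Function.update (fun _ => B) k Y) = (List.replicate n B).set k Y := by
    refine List.ext_getElem (by simp) fun i h1 h2 => ?_
    simp [List.getElem_set, Function.update_apply, Fin.ext_iff, eq_comm]
  rw [h, List.prod_set]
  simp [Nat.sub_sub, Nat.add_comm 1]

/-- The leading 1 reflects A_1 = I. Truncated subtraction makes the exponent 0 for both `k = 0` and
`k = 1`. -/
theorem List.prod_ofFn_update_one_const {M : Type*} [Monoid M] {n : ℕ} (B Y : M)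
    (k : Fin (n + 1)) :
    (List.ofFn (Function.update (fun i : Fin (n + 1) => if (i : ℕ) = 0 then 1 else B) k Y)).prod =
      B ^ ((k : ℕ) - 1) * Y * B ^ (n - k) := by
  rw [List.ofFn_succ, List.prod_cons]
  induction k using Fin.cases with
  | zero => simp [Function.update_of_ne]
  | succ k =>
    have h : (fun i : Fin n => Function.update
        (fun i : Fin (n + 1) => if (i : ℕ) = 0 then 1 else B) k.succ Y i.succ) =
        Function.update (fun _ => B) k Y := by
      ext i
      simp [Function.update_apply]
    rw [h, List.prod_ofFn_update_const, Function.update_of_ne (Fin.succ_ne_zero k).symm]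
    simp [Nat.sub_sub, Nat.add_comm 1]

theorem List.prod_ofFn_update_add_smul {R A : Type*} [CommSemiring R] [Semiring A] [Algebra R A]
    {n : ℕ} (G : Fin n → A) (k : Fin n) (t : R) (H : A) :
    (List.ofFn (Function.update G k (G k + t • H))).prod =
      (List.ofFn G).prod + t • (List.ofFn (Function.update G k H)).prod := by
  have := (MultilinearMap.mkPiAlgebraFin R n A).map_update_add G k (G k) (t • H)
  rw [MultilinearMap.map_update_smul, Function.update_eq_self] at this
  simpa only [MultilinearMap.mkPiAlgebraFin_apply] using this

/-! ### Distinct ratios and interpolation on a cyclic diagonal -/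

/-- The ratios `(j + 1) / (j + s + 1)`, with `j` and `j + s` taken in `{0, …, n}`,
are pairwise distinct when `s ≠ 0`. -/
theorem ZMod.eq_of_val_succ_mul_val_succ_eq {n : ℕ} {s u v : ZMod (n + 1)} (hs : s ≠ 0)
    (h : (u.val + 1) * ((v + s).val + 1) = (v.val + 1) * ((u + s).val + 1)) : u = v := by
  have hs0 : 0 < s.val := Nat.pos_of_ne_zero ((ZMod.val_ne_zero s).mpr hs)
  have hsn : s.val < n + 1 := ZMod.val_lt s
  have key (x : ZMod (n + 1)) :
      (x + s).val = x.val + s.val ∨ (x + s).val + (n + 1) = x.val + s.val := by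
    rcases lt_or_ge (x.val + s.val) (n + 1) with hx | hx
    · exact .inl (ZMod.val_add_of_lt hx)
    · exact .inr (ZMod.val_add_val_of_le hx).symm
  apply ZMod.val_injective
  -- The ratio is below 1 without wrap-around and above 1 with it, so the mixed cases are
  -- impossible.
  rcases key u with hu | hu <;> rcases key v with hv | hv
  · rw [hu, hv] at h
    have : s.val * u.val = s.val * v.val := by linarith
    exact Nat.eq_of_mul_eq_mul_left hs0 this
  · exfalso
    zify at *
    have : (v + s).val = (v.val + s.val - (n + 1) : ℤ) := by linarith
    rw [this, hu] at h
    nlinarith [u.val.cast_nonneg (α := ℤ), v.val.cast_nonneg (α := ℤ),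
      mul_nonneg (u.val.cast_nonneg (α := ℤ)) (sub_nonneg.mpr hsn.le),
      mul_nonneg (v.val.cast_nonneg (α := ℤ)) hs0.le]
  · exfalso
    zify at *
    have : (u + s).val = (u.val + s.val - (n + 1) : ℤ) := by linarith
    rw [this, hv] at h
    nlinarith [u.val.cast_nonneg (α := ℤ), v.val.cast_nonneg (α := ℤ),
      mul_nonneg (v.val.cast_nonneg (α := ℤ)) (sub_nonneg.mpr hsn.le),
      mul_nonneg (u.val.cast_nonneg (α := ℤ)) hs0.le]
  · zify at *
    have hu' : (u + s).val = (u.val + s.val - (n + 1) : ℤ) := by linarith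
    have hv' : (v + s).val = (v.val + s.val - (n + 1) : ℤ) := by linarith
    rw [hu', hv'] at h
    have : (n + 1 - s.val : ℤ) * u.val = (n + 1 - s.val : ℤ) * v.val := by linarith
    exact mul_left_cancel₀ (by linarith) this

/-- If the points `(v j : w j)` of the projective line are pairwise distinct, then binary forms
of degree `n` interpolate arbitrary values at `n + 1` of them. -/
theorem exists_sum_pow_mul_pow_eq_single {K ι : Type*} [Field K] [DecidableEq ι] {n : ℕ}
    (ε : Fin (n + 1) ≃ ι) (v w : ι → K) (h : ∀ i j, v i * w j = v j * w i → i = j) (i : ι) :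
    ∃ c : Fin (n + 1) → K, ∀ j, ∑ k, c k * (v j ^ (k : ℕ) * w j ^ (n - k)) =
      (Pi.single i 1 : ι → K) j := by
  have hdet : (Matrix.projVandermonde (v ∘ ε) (w ∘ ε)).det ≠ 0 := by
    rw [Matrix.det_projVandermonde]
    refine Finset.prod_ne_zero_iff.mpr fun a _ => Finset.prod_ne_zero_iff.mpr fun b hb => ?_
    exact sub_ne_zero.mpr fun hab => (Finset.mem_Ioi.mp hb).ne' (ε.injective (h _ _ hab))
  set V := Matrix.projVandermonde (v ∘ ε) (w ∘ ε) with hV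
  refine ⟨V⁻¹ *ᵥ Pi.single (ε.symm i) 1, fun j => ?_⟩
  have hmul : V *ᵥ (V⁻¹ *ᵥ Pi.single (ε.symm i) 1) = Pi.single (ε.symm i) 1 := by
    rw [Matrix.mulVec_mulVec, Matrix.mul_nonsing_inv _ hdet.isUnit, Matrix.one_mulVec]
  have hj := congrFun hmul (ε.symm j)
  simp only [Pi.single_apply, EmbeddingLike.apply_eq_iff_eq] at hj ⊢
  rw [← hj, Matrix.mulVec, dotProduct]
  refine Finset.sum_congr rfl fun k _ => ?_
  rw [hV, Matrix.projVandermonde_apply, Fin.val_rev, Nat.add_sub_add_right]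
  simp only [Function.comp_apply, Equiv.apply_symm_apply]
  ring

/-- If the ratios `b j / b (j + s)` are pairwise distinct, then every matrix supported on the
`s`-th cyclic diagonal is a combination of the matrices `B ^ k * S * B ^ (n - k)`, where
`B = diag b` and `S` is the cyclic shift by `s`. -/
theorem exists_sum_diagonal_pow_mul_shift_mul_eq_single {n : ℕ} (b : ZMod (n + 1) → ℂ)
    (s : ZMod (n + 1)) (hb : ∀ u v, b u * b (v + s) = b v * b (u + s) → u = v)
    (i : ZMod (n + 1)) :
    ∃ c : Fin (n + 1) → ℂ, ∑ k, c k • (Matrix.diagonal b ^ (k : ℕ) *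
      (Matrix.of fun j l => if l = j + s then (1 : ℂ) else 0) *
      Matrix.diagonal b ^ (n - k)) = Matrix.single i (i + s) 1 := by
  obtain ⟨c, hc⟩ := exists_sum_pow_mul_pow_eq_single (ZMod.finEquiv (n + 1)).toEquiv b
    (fun u => b (u + s)) hb i
  refine ⟨c, ?_⟩
  ext j l
  simp only [Matrix.sum_apply, Matrix.smul_apply, Matrix.diagonal_pow, Matrix.mul_diagonal,
    Matrix.diagonal_mul, Matrix.of_apply, Pi.pow_apply, smul_eq_mul, Matrix.single_apply]
  by_cases hl : l = j + s
  · subst hl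
    simp only [add_left_inj, and_self, if_true, mul_one, hc, Pi.single_apply, eq_comm]
  · have : ¬ (i = j ∧ i + s = l) := by
      rintro ⟨rfl, rfl⟩
      exact hl rfl
    simp [hl, this]

/-! ### The product as a polynomial map, and its velocities -/

/-- The product of `N` AFDF factors with first diagonal `A_1 = I`, as a matrix of polynomials in
the other diagonal entries. -/
noncomputable def afdfPolynomial (N : ℕ) [NeZero N] :
    Matrix (ZMod N) (ZMod N) (MvPolynomial (Fin N × ZMod N ⊕ Fin N × ZMod N) ℂ) :=
  (List.ofFn fun k : Fin N =>
    Matrix.diagonal (fun j => if (k : ℕ) = 0 then 1 else MvPolynomial.X (Sum.inl (k, j))) *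
      (dftMatrix N).map MvPolynomial.C *
      Matrix.diagonal (fun j => MvPolynomial.X (Sum.inr (k, j))) *
      (dftMatrix N)⁻¹.map MvPolynomial.C).prod

theorem eval_afdfPolynomial (N : ℕ) [NeZero N] (x : Fin N × ZMod N ⊕ Fin N × ZMod N → ℂ) :
    (afdfPolynomial N).map (MvPolynomial.eval x) =
      afdfProduct N N (fun k j => if (k : ℕ) = 0 then 1 else x (Sum.inl (k, j)))
        (fun k j => x (Sum.inr (k, j))) := by
  have hC (M : Matrix (ZMod N) (ZMod N) ℂ) :
      (M.map (MvPolynomial.C (σ := Fin N × ZMod N ⊕ Fin N × ZMod N))).map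
        (MvPolynomial.eval x) = M := by
    ext; simp
  rw [← RingHom.mapMatrix_apply, afdfPolynomial, map_list_prod, List.map_ofFn, afdfProduct]
  congr 2
  funext k
  simp only [Function.comp_apply, map_mul, RingHom.mapMatrix_apply, hC, afdfFactor]
  congr 3
  · rw [Matrix.diagonal_map (map_zero _)]
    congr 1
    funext j
    simp only [apply_ite (MvPolynomial.eval x), map_one, MvPolynomial.eval_X]
  · rw [Matrix.diagonal_map (map_zero _)]
    simp

theorem mainTheorem1 (N : ℕ) [NeZero N] :
    Dense (afdfOperators N N) := by
  have hdense : DenseRange fun (x : Fin N × ZMod N ⊕ Fin N × ZMod N → ℂ)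
      (i : ZMod N × ZMod N) => MvPolynomial.eval x (afdfPolynomial N i.1 i.2) := by
    obtain ⟨n, rfl⟩ := Nat.exists_eq_succ_of_ne_zero (NeZero.ne N)
    set b : ZMod (n + 1) → ℂ := fun j => j.val + 1 with hb
    have hb0 (j) : b j ≠ 0 := Nat.cast_add_one_ne_zero _
    set B := Matrix.diagonal b with hB
    set G : Fin (n + 1) → Matrix (ZMod (n + 1)) (ZMod (n + 1)) ℂ :=
      fun k => if (k : ℕ) = 0 then 1 else B with hG
    set p : Fin (n + 1) × ZMod (n + 1) ⊕ Fin (n + 1) × ZMod (n + 1) → ℂ :=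
      Sum.elim (fun i => b i.2) 1 with hp
    refine MvPolynomial.denseRange_of_span_eq_top _ p ?_
    set T := Submodule.span ℂ {v : ZMod (n + 1) × ZMod (n + 1) → ℂ | ∃ u, ∀ (t : ℂ) i,
      MvPolynomial.eval (p + t • u) (afdfPolynomial (n + 1) i.1 i.2) =
        MvPolynomial.eval p (afdfPolynomial (n + 1) i.1 i.2) + t * v i}
    let e : Matrix (ZMod (n + 1)) (ZMod (n + 1)) ℂ →ₗ[ℂ] (ZMod (n + 1) × ZMod (n + 1) → ℂ) :=
      { toFun := fun M i => M i.1 i.2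
        map_add' := fun _ _ => rfl
        map_smul' := fun _ _ => rfl }
    have hvel (k : Fin (n + 1)) (H : Matrix (ZMod (n + 1)) (ZMod (n + 1)) ℂ)
        (u : Fin (n + 1) × ZMod (n + 1) ⊕ Fin (n + 1) × ZMod (n + 1) → ℂ)
        (hu : ∀ (t : ℂ) (l : Fin (n + 1)), afdfFactor (n + 1)
          (fun j => if (l : ℕ) = 0 then 1 else (p + t • u) (Sum.inl (l, j)))
          (fun j => (p + t • u) (Sum.inr (l, j))) = Function.update G k (G k + t • H) l) :
        B ^ ((k : ℕ) - 1) * H * B ^ (n - k) ∈ T.comap e := by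
      have hprod (t : ℂ) : (afdfPolynomial (n + 1)).map (MvPolynomial.eval (p + t • u)) =
          (List.ofFn G).prod + t • (B ^ ((k : ℕ) - 1) * H * B ^ (n - k)) := by
        rw [← List.prod_ofFn_update_one_const, ← List.prod_ofFn_update_add_smul,
          eval_afdfPolynomial, afdfProduct]
        congr 2
        exact funext (hu t)
      refine Submodule.subset_span ⟨u, fun t i => ?_⟩
      have h0 := hprod 0
      rw [zero_smul, zero_smul, add_zero, add_zero] at h0
      have ht := hprod t
      rw [← h0] at ht
      exact congrFun (congrFun ht i.1) i.2
    have hbase (l : Fin (n + 1)) :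
        Matrix.diagonal (fun j => if (l : ℕ) = 0 then 1 else p (Sum.inl (l, j))) = G l := by
      by_cases hl : (l : ℕ) = 0
      · simp only [hG, hl, if_true, Matrix.diagonal_one]
      · simp only [hG, hl, if_false, hp, Sum.elim_inl, hB]
    have hshift (s : ZMod (n + 1)) (k : Fin (n + 1)) :
        B ^ (k : ℕ) * (Matrix.of fun j l => if l = j + s then (1 : ℂ) else 0) * B ^ (n - k) ∈
          T.comap e := by
      have := hvel k (G k * Matrix.of fun j l => if l = j + s then (1 : ℂ) else 0)
        (Sum.elim 0 fun i => if i.1 = k then ZMod.stdAddChar (-(s * i.2)) else 0) fun t l => ?_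
      · convert this using 1
        rw [← Matrix.mul_assoc]
        congr 2
        by_cases hk : (k : ℕ) = 0
        · simp only [hG, hk, if_true, pow_zero, Nat.zero_sub, one_mul]
        · simp only [hG, hk, if_false]
          exact (pow_sub_one_mul hk B).symm
      · rw [← hbase, ← afdfFactor_stdAddChar]
        by_cases hl : l = k
        · subst hl
          rw [Function.update_self, ← afdfFactor_one_right, ← afdfFactor_add_smul_right]
          congr 1 <;> funext j <;> simp [hp]
        · rw [Function.update_of_ne hl, ← hbase, ← afdfFactor_one_right]
          congr 1 <;> funext j <;> simp [hp, hl]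
    have hsingle (i j : ZMod (n + 1)) : Matrix.single i j 1 ∈ T.comap e := by
      -- For shift 0 every `B ^ k * S * B ^ (n - k)` is `B ^ n`, which suffices only when `n = 0`.
      by_cases hij : j - i ≠ 0 ∨ n = 0
      · obtain ⟨c, hc⟩ := exists_sum_diagonal_pow_mul_shift_mul_eq_single b (j - i)
          (fun u v huv => by
            rcases hij with hij | rfl
            · exact ZMod.eq_of_val_succ_mul_val_succ_eq hij (by
                simp only [hb] at huv
                exact_mod_cast huv)
            · exact Subsingleton.elim (α := Fin 1) u v) i
        rw [add_sub_cancel] at hc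
        rw [← hc]
        exact Submodule.sum_mem _ fun k _ => Submodule.smul_mem _ _ (hshift _ k)
      · push Not at hij
        obtain ⟨hij, hn⟩ := hij
        obtain rfl := sub_eq_zero.mp hij
        have h1 : 1 < n + 1 := by omega
        -- Index 1 is the first free A; the inverse power cancels the trailing `B ^ (n - 1)`.
        have := hvel ⟨1, h1⟩ (Matrix.diagonal (Pi.single j (b j ^ (n - 1))⁻¹))
          (Sum.elim (fun l => if l.1 = ⟨1, h1⟩ then
            (Pi.single j (b j ^ (n - 1))⁻¹ : ZMod (n + 1) → ℂ) l.2 else 0) 0) fun t l => ?_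
        · convert this using 1
          ext u v
          simp only [Nat.sub_self, pow_zero, one_mul, hB, Matrix.diagonal_pow,
            Matrix.diagonal_mul_diagonal, Matrix.diagonal_apply, Matrix.single_apply,
            Pi.single_apply, Pi.pow_apply]
          by_cases hu : u = j
          · subst hu
            by_cases huv : u = v
            · simp [huv, hb0]
            · simp [huv]
          · simp [hu, Ne.symm hu]
        · by_cases hl : l = ⟨1, h1⟩
          · subst hl
            rw [Function.update_self, ← hbase, ← afdfFactor_one_right, ← afdfFactor_one_right,
              ← afdfFactor_add_smul_left]
            congr 1
            funext j
            simp [hp]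
          · rw [Function.update_of_ne hl, ← hbase, ← afdfFactor_one_right]
            congr 1 <;> funext j <;> simp [hp, hl]
    rw [eq_top_iff]
    rintro v -
    have hv : Matrix.of (fun i j => v (i, j)) ∈ T.comap e := by
      rw [Matrix.matrix_eq_sum_single (Matrix.of fun i j => v (i, j))]
      refine Submodule.sum_mem _ fun i _ => Submodule.sum_mem _ fun j _ => ?_
      rw [← mul_one (Matrix.of (fun i j => v (i, j)) i j), ← smul_eq_mul, ← Matrix.smul_single]
      exact Submodule.smul_mem _ _ (hsingle i j)
    exact hv
  have hcont : Continuous fun (v : ZMod N × ZMod N → ℂ) => Matrix.of fun i j => v (i, j) :=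
    continuous_matrix fun i j => continuous_apply (i, j)
  have hsurj : Function.Surjective
      fun (v : ZMod N × ZMod N → ℂ) => Matrix.of fun i j => v (i, j) :=
    fun M => ⟨fun i => M i.1 i.2, rfl⟩
  refine (hsurj.denseRange.comp hdense hcont).mono ?_
  rintro _ ⟨x, rfl⟩
  refine ⟨_, _, fun k hk => ?_, eval_afdfPolynomial N x⟩
  simp [hk]
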